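/- Let $m\ge 1$ be an integer and let $\delta_0,\delta_1\in(-m,+\infty)$. For each $n\ge 1$ let $\tau_n$ be an integer with $1\le\tau_n\le n$, and put $\Delta_n=n-\tau_n$. For a function $\delta\colon\mathbb{N}\to(-m,+\infty)$, the preferential attachment graph $G_n$ is the random labeled directed multigraph on $\{0,\dots,n\}$ built as follows. $G_1$ consists of $m$ edges from $1$ to $0$. For $t\ge 2$, $G_t$ is obtained from $G_{t-1}$ by adding the vertex $t$ and then, successively for $i=1,\dots,m$, an edge from $t$ to a random vertex of $\{0,\dots,t-1\}$; given the graph $G_{t,i-1}$ present before the $i$-th of these edges is added, this vertex is $v$ with probability $$\frac{\mathsf{d}_{G_{t,i-1}}(v)+\delta(t)}{\sum_{v'=0}^{t-1}\big(\mathsf{d}_{G_{t,i-1}}(v')+\delta(t)\big)},$$ where $\mathsf{d}$ denotes the total degree (in-degree plus out-degree, with multiplicity). Let $Q_0^n$ be the law of $G_n$ when $\delta(t)=\delta_0$ for all $t$, and $Q_1^n$ its law when $\delta(t)=\delta_0\mathbf{1}_{t\le\tau_n}+\delta_1\mathbf{1}_{t>\tau_n}$. A test is a function $\phi_n$ of $G_n$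 with values in $[0,1]$; say that detection is possible if there are tests $\phi_n$ with $\mathbb{E}_{Q_0^n}[\phi_n]+\mathbb{E}_{Q_1^n}[1-\phi_n]\to 0$ as $n\to\infty$. 1. If $\delta_0\ne\delta_1$, $\tau_n\to\infty$ and $\Delta_n\to\infty$, then the likelihood-ratio test $T_n=\mathbf{1}\big(\frac{\mathrm{d}Q_1^n}{\mathrm{d}Q_0^n}(G_n)>1\big)$ satisfies $\mathbb{E}_{Q_0^n}[T_n]+\mathbb{E}_{Q_1^n}[1-T_n]\to 0$. 2. If $\limsup_{n\to\infty}\Delta_n<+\infty$, then $(Q_1^n)_{n\ge1}$ is contiguous with respect to $(Q_0^n)_{n\ge1}$: for all sets $A_n$ of labeled graphs on $\{0,\dots,n\}$, $Q_0^n(A_n)\to 0$ implies $Q_1^n(A_n)\to 0$. 3. If detection is possible, then $\Delta_n\to\infty$. Consequently, if $\delta_0\ne\delta_1$ and $\tau_n\to\infty$, detection is possible if and only if $\Delta_n\to\infty$. -/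

import Mathlib

open MeasureTheory Filter Topology

/-- A labeled directed multigraph without loops on the vertex set `{0, …, n}`; the pair `(u, v)` is
an edge with arrow from `u` to `v`. -/
@[ext]
structure LabeledGraph (n : ℕ) where
  edges : Multiset (Fin (n + 1) × Fin (n + 1))
  loopless : ∀ e ∈ edges, e.1 ≠ e.2

namespace LabeledGraph

/-- Every set of labeled graphs on `{0, …, n}` is an event. -/
instance (n : ℕ) : MeasurableSpace (LabeledGraph n) := ⊤

instance (n : ℕ) : DiscreteMeasurableSpace (LabeledGraph n) := ⟨fun _ => trivial⟩

variable {n : ℕ}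

/-- In-degree, counted with multiplicity. -/
def inDegree (G : LabeledGraph n) (v : Fin (n + 1)) : ℕ := G.edges.countP (fun e => e.2 = v)

/-- Out-degree, counted with multiplicity. -/
def outDegree (G : LabeledGraph n) (v : Fin (n + 1)) : ℕ := G.edges.countP (fun e => e.1 = v)

/-- Total degree, counted with multiplicity. -/
def degree (G : LabeledGraph n) (v : Fin (n + 1)) : ℕ := G.inDegree v + G.outDegree v

/-- The graph with vertices `0, …, n` and no edge. -/
def edgeless (n : ℕ) : LabeledGraph n := ⟨0, by simp⟩

/-- Add an isolated vertex with the next label `n + 1`; the old vertices keep their labels. -/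
def addVertex (G : LabeledGraph n) : LabeledGraph (n + 1) where
  edges := G.edges.map (fun e => (e.1.castSucc, e.2.castSucc))
  loopless := by
    intro e he
    obtain ⟨a, ha, rfl⟩ := Multiset.mem_map.1 he
    simpa using G.loopless a ha

/-- Add one edge from the vertex with the largest label, `n + 1`, to the vertex `v ∈ {0, …, n}`. -/
def addEdge (G : LabeledGraph (n + 1)) (v : Fin (n + 1)) : LabeledGraph (n + 1) where
  edges := (Fin.last (n + 1), v.castSucc) ::ₘ G.edges
  loopless := by
    intro e he
    rcases Multiset.mem_cons.1 he with rfl | h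
    · exact (Fin.castSucc_lt_last v).ne'
    · exact G.loopless e h

end LabeledGraph

open Classical in
/-- The law on `{0, …, n}` giving `v` the probability `w v / ∑ v', w v'`, for positive weights `w`.
(For other weights, which do not occur in the model below because every attachment target has
degree at least `m` and the attachment parameter exceeds `-m`, the value is a placeholder.) -/
noncomputable def weightedChoice {n : ℕ} (w : Fin (n + 1) → ℝ) : PMF (Fin (n + 1)) :=
  if h : ∀ v, 0 < w v then
    PMF.ofFintype (fun v => ENNReal.ofReal (w v / ∑ v', w v')) (by
      have hs : 0 < ∑ v', w v' := Finset.sum_pos (fun v _ => h v) Finset.univ_nonempty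
      rw [← ENNReal.ofReal_sum_of_nonneg (fun v _ => (div_pos (h v) hs).le), ← Finset.sum_div,
        div_self hs.ne', ENNReal.ofReal_one])
  else PMF.pure 0

/-- Starting from a graph `G` on `{0, …, n + 1}`, add successively `i` random edges from vertex
`n + 1`: given the current graph `G'`, the endpoint of the next edge is `v ∈ {0, …, n}` with
probability proportional to `deg_{G'} v + d`. -/
noncomputable def attachEdges {n : ℕ} (d : ℝ) (G : LabeledGraph (n + 1)) :
    ℕ → PMF (LabeledGraph (n + 1))
  | 0 => PMF.pure G
  | i + 1 => (attachEdges d G i).bind fun G' =>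
      (weightedChoice fun v : Fin (n + 1) => (G'.degree v.castSucc : ℝ) + d).map G'.addEdge

/-- The law of the preferential attachment graph `G_n` on `{0, …, n}` with `m` edges per step and
attachment parameter `δ t` at time `t`. The graph `G_1` consists of `m` edges from `1` to `0`; for
`t ≥ 2`, `G_t` is obtained from `G_{t-1}` by adding the vertex `t` and then, one at a time, `m`
edges from `t`. -/
noncomputable def prefAttachLaw (m : ℕ) (δ : ℕ → ℝ) : (n : ℕ) → PMF (LabeledGraph n)
  | 0 => PMF.pure (LabeledGraph.edgeless 0)
  | 1 => PMF.pure ((fun G : LabeledGraph 1 => G.addEdge 0)^[m] (LabeledGraph.edgeless 1))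
  | n + 2 => (prefAttachLaw m δ (n + 1)).bind fun G => attachEdges (δ (n + 2)) G.addVertex m

/-- Attachment parameter equal to `δ₀` up to time `τ` and to `δ₁` afterwards. -/
noncomputable def changeParam (δ₀ δ₁ : ℝ) (τ : ℕ) (t : ℕ) : ℝ := if t ≤ τ then δ₀ else δ₁

/-- The law of `G_n` under the null hypothesis (no change). -/
noncomputable def nullLaw (m : ℕ) (δ₀ : ℝ) (n : ℕ) : Measure (LabeledGraph n) :=
  (prefAttachLaw m (fun _ => δ₀) n).toMeasure

/-- The law of `G_n` under the alternative (change from `δ₀` to `δ₁` after time `τ`). -/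
noncomputable def altLaw (m : ℕ) (δ₀ δ₁ : ℝ) (τ : ℕ) (n : ℕ) : Measure (LabeledGraph n) :=
  (prefAttachLaw m (changeParam δ₀ δ₁ τ) n).toMeasure

/-- Type I error plus type II error of a (possibly randomized) test `φ` of `Q₀` against `Q₁`. -/
noncomputable def errorSum {X : Type*} [MeasurableSpace X] (Q₀ Q₁ : Measure X) (φ : X → ℝ) : ℝ :=
  ∫ x, φ x ∂Q₀ + ∫ x, (1 - φ x) ∂Q₁

/-- The likelihood-ratio test `1(dQ₁/dQ₀ > 1)`. -/
noncomputable def likelihoodRatioTest {X : Type*} [MeasurableSpace X] (Q₀ Q₁ : Measure X) : X → ℝ :=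
  Set.indicator {x | 1 < Q₁.rnDeriv Q₀ x} 1

/-- `(Q n)` is contiguous with respect to `(P n)`: whenever `P n (A n) → 0`, also
`Q n (A n) → 0`. -/
def Contiguous {X : ℕ → Type*} [∀ n, MeasurableSpace (X n)] (Q P : ∀ n, Measure (X n)) : Prop :=
  ∀ A : ∀ n, Set (X n), (∀ n, MeasurableSet (A n)) →
    Tendsto (fun n => P n (A n)) atTop (𝓝 0) → Tendsto (fun n => Q n (A n)) atTop (𝓝 0)

/-- Some sequence of (possibly randomized) tests of `P n` against `Q n` has a sum of errors tending
to `0`. -/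
def DetectionPossible {X : ℕ → Type*} [∀ n, MeasurableSpace (X n)] (P Q : ∀ n, Measure (X n)) :
    Prop :=
  ∃ φ : ∀ n, X n → ℝ, (∀ n, Measurable (φ n)) ∧ (∀ n x, φ n x ∈ Set.Icc (0 : ℝ) 1) ∧
    Tendsto (fun n => errorSum (P n) (Q n) (φ n)) atTop (𝓝 0)

/-! Impossibility: every attachment weight is `k + δ` with `k ≥ m`, so switching between `δ₀` and
`δ₁` changes weights, and hence one-edge probabilities, by bounded factors. The likelihood ratio is
therefore at most `C ^ (n - τ)` (`exists_altLaw_le`). If `n - τ` stays bounded this gives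
contiguity, and a test with vanishing errors forces `n - τ → ∞`.

Detection: the likelihood-ratio test minimizes the sum of errors
(`errorSum_likelihoodRatioTest_le`), so any good test suffices. Labels are arrival times, so the
final graph determines all earlier ones, and a statistic may sum over the history (`pathSum`). The
one used counts edges sent after the change to vertices of minimal degree `m`. If `N` vertices have
degree `m`, the conditional mean of this count at one step is `m (m + d) / totalWeight m d n * N`
(`expect_hits`). Centered by the means for the true parameter, the sum is a martingale with second
moment at most `m² (n - τ)`. Changing the centering from `δ₁` to `δ₀` adds a drift with the sign of
`δ₁ - δ₀`, of order `N / n` per step.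

It remains to keep `N / n` away from `0`. A step creates one vertex of degree `m` and destroys at
most as many as there are hits, which pushes `N` up to at least `n / (m + 1)` whatever the
parameter; the squared shortfall has mean at most `m² n` (`expect_sq_shortfall_le`). Chebyshev and
Markov then bound the errors by `A / (n - τ) + B / τ` (`exists_errorSum_le`). -/

namespace LabeledGraph

/-! ### Degrees, restriction to the past, and one-step extensions. -/

variable {n : ℕ}

theorem degree_addVertex_castSucc (G : LabeledGraph n) (v : Fin (n + 1)) :
    G.addVertex.degree v.castSucc = G.degree v := by
  simp only [degree, inDegree, outDegree, addVertex, Multiset.countP_map, Fin.castSucc_inj]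
  simp only [Multiset.countP_eq_card_filter]

theorem degree_addVertex_last (G : LabeledGraph n) :
    G.addVertex.degree (Fin.last (n + 1)) = 0 := by
  simp [degree, inDegree, outDegree, addVertex, Multiset.countP_map, Fin.castSucc_ne_last]

theorem degree_addEdge_castSucc (G : LabeledGraph (n + 1)) (u v : Fin (n + 1)) :
    (G.addEdge v).degree u.castSucc = G.degree u.castSucc + if u = v then 1 else 0 := by
  have h : ¬ Fin.last (n + 1) = u.castSucc := (Fin.castSucc_lt_last u).ne'
  simp only [degree, inDegree, outDegree, addEdge, Multiset.countP_cons, Fin.castSucc_inj, h,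
    if_false, eq_comm (a := v)]
  omega

theorem degree_addEdge_last (G : LabeledGraph (n + 1)) (v : Fin (n + 1)) :
    (G.addEdge v).degree (Fin.last (n + 1)) = G.degree (Fin.last (n + 1)) + 1 := by
  have h : ¬ v.castSucc = Fin.last (n + 1) := (Fin.castSucc_lt_last v).ne
  simp only [degree, inDegree, outDegree, addEdge, Multiset.countP_cons, h, if_false, if_true]
  omega

/-- The induced subgraph on `{0, …, n}` of a graph on `{0, …, n + 1}`. -/
def restrict (H : LabeledGraph (n + 1)) : LabeledGraph n where
  edges := H.edges.filterMap fun e =>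
    if h : e.1 ≠ Fin.last (n + 1) ∧ e.2 ≠ Fin.last (n + 1) then
      some (e.1.castPred h.1, e.2.castPred h.2) else none
  loopless := by
    intro e he
    obtain ⟨a, ha, hae⟩ := (Multiset.mem_filterMap _ _).1 he
    split_ifs at hae with h
    obtain rfl := Option.some.inj hae
    intro h'
    exact H.loopless a ha ((Fin.castPred_inj (hi := h.1) (hj := h.2)).1 h')

theorem restrict_addVertex (G : LabeledGraph n) : G.addVertex.restrict = G := by
  ext1
  simp only [restrict, addVertex, Multiset.filterMap_map]
  conv_rhs => rw [← Multiset.filterMap_some G.edges]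
  congr 1
  funext e
  simp [Fin.castSucc_ne_last]

theorem restrict_addEdge (H : LabeledGraph (n + 1)) (v : Fin (n + 1)) :
    (H.addEdge v).restrict = H.restrict := by
  ext1
  simp only [restrict, addEdge]
  rw [Multiset.filterMap_cons_none]
  simp

/-- The vertices of degree `m`. -/
def verticesOfDegree (m : ℕ) (G : LabeledGraph n) : Finset (Fin (n + 1)) :=
  Finset.univ.filter fun v => G.degree v = m

/-- The number of edges from the last vertex to vertices which had degree `m` before the last
vertex was added. -/
def hits (m : ℕ) (H : LabeledGraph (n + 1)) : ℝ :=
  ∑ v ∈ H.restrict.verticesOfDegree m, ((H.degree v.castSucc : ℝ) - m)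

/-- All degrees are at least `m` and the sum of the degrees is `2 m n`. -/
def IsGood (m : ℕ) (G : LabeledGraph n) : Prop :=
  (∑ v, G.degree v = 2 * m * n) ∧ ∀ v, m ≤ G.degree v

/-- `H` may arise from `G` by adding a last vertex and `i` edges issued from it. -/
structure IsExtension (G : LabeledGraph n) (i : ℕ) (H : LabeledGraph (n + 1)) : Prop where
  restrict_eq : H.restrict = G
  degree_last : H.degree (Fin.last (n + 1)) = i
  degree_le : ∀ v, G.degree v ≤ H.degree (Fin.castSucc v)
  sum_degree : ∑ v : Fin (n + 1), H.degree v.castSucc = ∑ v, G.degree v + i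

theorem isExtension_addVertex (G : LabeledGraph n) : IsExtension G 0 G.addVertex where
  restrict_eq := G.restrict_addVertex
  degree_last := G.degree_addVertex_last
  degree_le v := (G.degree_addVertex_castSucc v).ge
  sum_degree := by simp [degree_addVertex_castSucc]

theorem IsExtension.addEdge {G : LabeledGraph n} {i : ℕ} {H : LabeledGraph (n + 1)}
    (h : IsExtension G i H) (v : Fin (n + 1)) : IsExtension G (i + 1) (H.addEdge v) where
  restrict_eq := (H.restrict_addEdge v).trans h.restrict_eq
  degree_last := by rw [degree_addEdge_last, h.degree_last]
  degree_le u := by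
    rw [degree_addEdge_castSucc]
    exact (h.degree_le u).trans (Nat.le_add_right _ _)
  sum_degree := by
    simp [degree_addEdge_castSucc, Finset.sum_add_distrib, h.sum_degree, add_assoc]

theorem IsExtension.isGood {m : ℕ} {G : LabeledGraph n} (hG : G.IsGood m)
    {H : LabeledGraph (n + 1)} (h : IsExtension G m H) : H.IsGood m := by
  refine ⟨?_, fun v => ?_⟩
  · rw [Fin.sum_univ_castSucc, h.sum_degree, h.degree_last, hG.1]
    ring
  · induction v using Fin.lastCases with
    | last => exact h.degree_last.ge
    | cast v => exact (hG.2 v).trans (h.degree_le v)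

theorem IsExtension.hits_nonneg {m : ℕ} {G : LabeledGraph n} (hG : G.IsGood m)
    {H : LabeledGraph (n + 1)} (h : IsExtension G m H) : 0 ≤ H.hits m :=
  Finset.sum_nonneg fun v _ => sub_nonneg.2 (by exact_mod_cast (hG.2 v).trans (h.degree_le v))

theorem IsExtension.hits_le {m : ℕ} {G : LabeledGraph n}
    {H : LabeledGraph (n + 1)} (h : IsExtension G m H) : H.hits m ≤ m := by
  have h1 : H.hits m = ∑ v ∈ G.verticesOfDegree m, ((H.degree v.castSucc : ℝ) - G.degree v) := by
    rw [hits, h.restrict_eq]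
    refine Finset.sum_congr rfl fun v hv => ?_
    rw [(Finset.mem_filter.1 hv).2]
  have h2 : ∑ v ∈ G.verticesOfDegree m, ((H.degree v.castSucc : ℝ) - G.degree v) ≤
      ∑ v, ((H.degree (Fin.castSucc v) : ℝ) - G.degree v) :=
    Finset.sum_le_sum_of_subset_of_nonneg (Finset.subset_univ _)
      fun v _ _ => sub_nonneg.2 (by exact_mod_cast h.degree_le v)
  have h3 : (∑ v : Fin (n + 1), (H.degree v.castSucc : ℝ)) = ∑ v, (G.degree v : ℝ) + m := by
    exact_mod_cast h.sum_degree
  rw [← h1, Finset.sum_sub_distrib, h3] at h2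
  linarith

/-- The new vertex has degree `m`, and an old vertex that leaves degree `m` accounts for at least
one hit. Equality can fail when one vertex is hit several times; only a lower bound on the count is
needed. -/
theorem IsExtension.card_le {m : ℕ} {G : LabeledGraph n} (hG : G.IsGood m)
    {H : LabeledGraph (n + 1)} (h : IsExtension G m H) :
    ((G.verticesOfDegree m).card : ℝ) + 1 ≤ (H.verticesOfDegree m).card + H.hits m := by
  set B := (G.verticesOfDegree m).filter fun v => H.degree v.castSucc = m with hB
  have h1 : B.card + 1 ≤ (H.verticesOfDegree m).card := by
    rw [← Finset.card_map Fin.castSuccEmb (s := B), ← Finset.card_cons (a := Fin.last (n + 1))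
      (s := B.map Fin.castSuccEmb) (by simp [Fin.castSucc_ne_last])]
    refine Finset.card_le_card fun v hv => ?_
    rcases Finset.mem_cons.1 hv with rfl | hv
    · simp [verticesOfDegree, h.degree_last]
    · obtain ⟨u, hu, rfl⟩ := Finset.mem_map.1 hv
      simpa [verticesOfDegree] using (Finset.mem_filter.1 hu).2
  have h2 : ((G.verticesOfDegree m).card : ℝ) ≤ B.card + H.hits m := by
    rw [hits, h.restrict_eq, hB, Finset.card_filter, Finset.card_eq_sum_ones]
    push_cast
    rw [← Finset.sum_add_distrib]
    refine Finset.sum_le_sum fun v _ => ?_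
    have hv : m ≤ H.degree v.castSucc := (hG.2 v).trans (h.degree_le v)
    split_ifs with hm
    · rw [hm]; simp
    · have : m + 1 ≤ H.degree v.castSucc := by omega
      have : (m : ℝ) + 1 ≤ H.degree v.castSucc := by exact_mod_cast this
      linarith
  have h3 : (B.card : ℝ) + 1 ≤ (H.verticesOfDegree m).card := by exact_mod_cast h1
  linarith

end LabeledGraph

/-! ### Expectation and domination for probability mass functions. -/

namespace PMF

variable {α β : Type*}

/-- The expectation of a real function under a probability mass function. -/
noncomputable def expect (p : PMF α) (f : α → ℝ) : ℝ := ∑' a, (p a).toReal * f a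

theorem expect_eq_sum {p : PMF α} {s : Finset α} (hs : p.support ⊆ s) (f : α → ℝ) :
    p.expect f = ∑ a ∈ s, (p a).toReal * f a :=
  tsum_eq_sum fun a ha => by
    rw [(p.apply_eq_zero_iff a).2 fun h => ha (hs h), ENNReal.toReal_zero, zero_mul]

theorem sum_toReal_eq_one {p : PMF α} {s : Finset α} (hs : p.support ⊆ s) :
    ∑ a ∈ s, (p a).toReal = 1 := by
  rw [← ENNReal.toReal_sum fun a _ => p.apply_ne_top a, ← tsum_eq_sum (L := .unconditional α),
    p.tsum_coe, ENNReal.toReal_one]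
  exact fun a ha => (p.apply_eq_zero_iff a).2 fun h => ha (hs h)

theorem expect_const {p : PMF α} (hp : p.support.Finite) (c : ℝ) : p.expect (fun _ => c) = c := by
  rw [expect_eq_sum hp.coe_toFinset.ge, ← Finset.sum_mul, sum_toReal_eq_one hp.coe_toFinset.ge,
    one_mul]

theorem expect_add {p : PMF α} (hp : p.support.Finite) (f g : α → ℝ) :
    p.expect (fun a => f a + g a) = p.expect f + p.expect g := by
  simp only [expect_eq_sum hp.coe_toFinset.ge, mul_add, Finset.sum_add_distrib]

theorem expect_const_mul (p : PMF α) (c : ℝ) (f : α → ℝ) :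
    p.expect (fun a => c * f a) = c * p.expect f := by
  simp only [expect, mul_left_comm _ c, tsum_mul_left]

theorem expect_mono {p : PMF α} (hp : p.support.Finite) {f g : α → ℝ}
    (h : ∀ a ∈ p.support, f a ≤ g a) : p.expect f ≤ p.expect g := by
  rw [expect_eq_sum hp.coe_toFinset.ge, expect_eq_sum hp.coe_toFinset.ge]
  exact Finset.sum_le_sum fun a ha =>
    mul_le_mul_of_nonneg_left (h a (hp.mem_toFinset.1 ha)) ENNReal.toReal_nonneg

theorem expect_congr {p : PMF α} {f g : α → ℝ} (h : ∀ a ∈ p.support, f a = g a) :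
    p.expect f = p.expect g := by
  refine tsum_congr fun a => ?_
  by_cases ha : a ∈ p.support
  · rw [h a ha]
  · rw [(p.apply_eq_zero_iff a).2 ha, ENNReal.toReal_zero, zero_mul, zero_mul]

theorem expect_pure (a : α) (f : α → ℝ) : (pure a).expect f = f a := by
  rw [expect_eq_sum (s := {a}) (by simp)]
  simp

theorem support_bind_finite {p : PMF α} {q : α → PMF β} (hp : p.support.Finite)
    (hq : ∀ a, (q a).support.Finite) : (p.bind q).support.Finite := by
  rw [support_bind]
  exact hp.biUnion fun a _ => hq a

theorem expect_bind {p : PMF α} {q : α → PMF β} (hp : p.support.Finite)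
    (hq : ∀ a, (q a).support.Finite) (f : β → ℝ) :
    (p.bind q).expect f = p.expect fun a => (q a).expect f := by
  have hb := support_bind_finite hp hq
  have h1 : ∀ a ∈ hp.toFinset, (q a).support ⊆ hb.toFinset := fun a ha b hba => by
    rw [hb.coe_toFinset, mem_support_bind_iff]
    exact ⟨a, hp.mem_toFinset.1 ha, hba⟩
  have h2 : ∀ b, ((p.bind q) b).toReal = ∑ a ∈ hp.toFinset, (p a).toReal * (q a b).toReal := by
    intro b
    rw [bind_apply, tsum_eq_sum (s := hp.toFinset), ENNReal.toReal_sum]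
    · simp only [ENNReal.toReal_mul]
    · exact fun a _ => ENNReal.mul_ne_top (p.apply_ne_top a) ((q a).apply_ne_top b)
    · intro a ha
      rw [(p.apply_eq_zero_iff a).2 fun h => ha (hp.mem_toFinset.2 h), zero_mul]
  rw [expect_eq_sum hb.coe_toFinset.ge, expect_eq_sum hp.coe_toFinset.ge]
  simp only [h2, Finset.sum_mul]
  rw [Finset.sum_comm]
  refine Finset.sum_congr rfl fun a ha => ?_
  rw [expect_eq_sum (h1 a ha), Finset.mul_sum]
  exact Finset.sum_congr rfl fun b _ => mul_assoc _ _ _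

theorem expect_map {p : PMF α} (hp : p.support.Finite) (g : α → β) (f : β → ℝ) :
    (p.map g).expect f = p.expect fun a => f (g a) := by
  rw [← bind_pure_comp, expect_bind hp fun a => by simp]
  simp [expect_pure]

theorem integral_toMeasure_eq_expect [MeasurableSpace α] [DiscreteMeasurableSpace α] (p : PMF α)
    {f : α → ℝ} (hf : ∀ a, f a ∈ Set.Icc (0 : ℝ) 1) : ∫ a, f a ∂p.toMeasure = p.expect f := by
  rw [integral_eq_tsum]
  · rfl
  · refine Integrable.of_bound (C := 1) (Measurable.of_discrete.aestronglyMeasurable) ?_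
    refine ae_of_all _ fun a => ?_
    rw [Real.norm_of_nonneg (hf a).1]
    exact (hf a).2

/-- Comparing kernels on the support of `p'` is enough, since `p` vanishes off it as well. This
matters because degree bounds are only available for reachable graphs. -/
theorem bind_le_mul_bind {p p' : PMF α} {q q' : α → PMF β} {C D : ENNReal}
    (hp : ∀ a, p a ≤ C * p' a) (hq : ∀ a ∈ p'.support, ∀ b, q a b ≤ D * q' a b) (b : β) :
    p.bind q b ≤ C * D * p'.bind q' b := by
  rw [bind_apply, bind_apply, ← ENNReal.tsum_mul_left]
  refine ENNReal.tsum_le_tsum fun a => ?_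
  by_cases ha : a ∈ p'.support
  · calc p a * q a b ≤ (C * p' a) * (D * q' a b) := mul_le_mul' (hp a) (hq a ha b)
      _ = C * D * (p' a * q' a b) := by ring
  · have : p' a = 0 := (p'.apply_eq_zero_iff a).2 ha
    have : p a = 0 := by simpa [this] using hp a
    simp [this]

theorem map_le_mul_map {p p' : PMF α} {C : ENNReal} (hp : ∀ a, p a ≤ C * p' a) (g : α → β)
    (b : β) : p.map g b ≤ C * p'.map g b := by
  have := bind_le_mul_bind (q := pure ∘ g) (q' := pure ∘ g) (D := 1) hp
    (fun a _ b => by rw [one_mul]) b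
  rwa [mul_one] at this

theorem toMeasure_le_smul [MeasurableSpace α] {p p' : PMF α} {C : ENNReal}
    (hp : ∀ a, p a ≤ C * p' a) : p.toMeasure ≤ C • p'.toMeasure := by
  refine Measure.le_iff.2 fun s hs => ?_
  rw [Measure.smul_apply, smul_eq_mul, toMeasure_apply _ hs, toMeasure_apply _ hs,
    ← ENNReal.tsum_mul_left]
  refine ENNReal.tsum_le_tsum fun a => ?_
  by_cases ha : a ∈ s <;> simp [ha, hp a]

end PMF

/-! ### Optimality of the likelihood-ratio test and lower bounds on errors. -/

section Tests

variable {X : Type*} [MeasurableSpace X]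

/-- The sum of errors of a test, when `Q₁` is absolutely continuous with respect to `Q₀`. -/
theorem errorSum_eq {Q₀ Q₁ : Measure X} [IsFiniteMeasure Q₀] [IsProbabilityMeasure Q₁]
    (h : Q₁ ≪ Q₀) {φ : X → ℝ} (hφ : Measurable φ) (hφ' : ∀ x, φ x ∈ Set.Icc (0 : ℝ) 1) :
    errorSum Q₀ Q₁ φ = 1 + ∫ x, φ x * (1 - (Q₁.rnDeriv Q₀ x).toReal) ∂Q₀ := by
  have hb : ∀ x, ‖φ x‖ ≤ 1 := fun x => by
    rw [Real.norm_of_nonneg (hφ' x).1]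
    exact (hφ' x).2
  have h0 : Integrable φ Q₀ := .of_bound hφ.aestronglyMeasurable 1 (ae_of_all _ hb)
  have h1 : Integrable φ Q₁ := .of_bound hφ.aestronglyMeasurable 1 (ae_of_all _ hb)
  have h2 : Integrable (fun x => (Q₁.rnDeriv Q₀ x).toReal * φ x) Q₀ :=
    Measure.integrable_toReal_rnDeriv.mul_bdd hφ.aestronglyMeasurable (ae_of_all _ hb)
  have h3 : (fun x => φ x * (1 - (Q₁.rnDeriv Q₀ x).toReal)) =
      fun x => φ x - (Q₁.rnDeriv Q₀ x).toReal * φ x := by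
    funext x
    ring
  rw [h3, integral_sub h0 h2, integral_toReal_rnDeriv_mul h, errorSum,
    integral_sub (integrable_const _) h1]
  simp
  ring

theorem measurable_likelihoodRatioTest (Q₀ Q₁ : Measure X) :
    Measurable (likelihoodRatioTest Q₀ Q₁) :=
  measurable_one.indicator (measurableSet_lt measurable_const (Measure.measurable_rnDeriv _ _))

theorem likelihoodRatioTest_mem_Icc (Q₀ Q₁ : Measure X) (x : X) :
    likelihoodRatioTest Q₀ Q₁ x ∈ Set.Icc (0 : ℝ) 1 := by
  unfold likelihoodRatioTest
  by_cases hx : x ∈ {x | 1 < Q₁.rnDeriv Q₀ x} <;> simp [hx]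

/-- The likelihood-ratio test minimizes the sum of errors. -/
theorem errorSum_likelihoodRatioTest_le {Q₀ Q₁ : Measure X} [IsFiniteMeasure Q₀]
    [IsProbabilityMeasure Q₁] (h : Q₁ ≪ Q₀) {φ : X → ℝ} (hφ : Measurable φ)
    (hφ' : ∀ x, φ x ∈ Set.Icc (0 : ℝ) 1) :
    errorSum Q₀ Q₁ (likelihoodRatioTest Q₀ Q₁) ≤ errorSum Q₀ Q₁ φ := by
  have hint : ∀ ψ : X → ℝ, Measurable ψ → (∀ x, ψ x ∈ Set.Icc (0 : ℝ) 1) →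
      Integrable (fun x => ψ x * (1 - (Q₁.rnDeriv Q₀ x).toReal)) Q₀ := fun ψ hψ hψ' =>
    ((integrable_const 1).sub Measure.integrable_toReal_rnDeriv).bdd_mul hψ.aestronglyMeasurable
      (ae_of_all _ fun x => by
        rw [Real.norm_of_nonneg (hψ' x).1]
        exact (hψ' x).2)
  have hT := measurable_likelihoodRatioTest Q₀ Q₁
  have hT' := likelihoodRatioTest_mem_Icc Q₀ Q₁
  rw [errorSum_eq h hT hT', errorSum_eq h hφ hφ']
  -- The integrand `φ (1 - L)`, with `L` the likelihood ratio, is minimized pointwise by `φ = 1`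
  -- where `L > 1` and `φ = 0` elsewhere.
  refine add_le_add_right (integral_mono_ae (hint _ hT hT') (hint _ hφ hφ') ?_) 1
  filter_upwards [Q₁.rnDeriv_lt_top Q₀] with x hx
  by_cases hx1 : 1 < Q₁.rnDeriv Q₀ x
  · have h1 : 1 ≤ (Q₁.rnDeriv Q₀ x).toReal := by
      rw [← ENNReal.toReal_one]
      exact ENNReal.toReal_mono hx.ne hx1.le
    have h2 : likelihoodRatioTest Q₀ Q₁ x = 1 :=
      Set.indicator_of_mem (s := {x | 1 < Q₁.rnDeriv Q₀ x}) hx1 1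
    rw [h2]
    exact mul_le_mul_of_nonpos_right (hφ' x).2 (by linarith)
  · have h1 : (Q₁.rnDeriv Q₀ x).toReal ≤ 1 := by
      rw [← ENNReal.toReal_one]
      exact ENNReal.toReal_mono ENNReal.one_ne_top (not_lt.1 hx1)
    have h2 : likelihoodRatioTest Q₀ Q₁ x = 0 :=
      Set.indicator_of_notMem (s := {x | 1 < Q₁.rnDeriv Q₀ x}) hx1 1
    rw [h2, zero_mul]
    exact mul_nonneg (hφ' x).1 (by linarith)

/-- If `Q₁ ≤ C Q₀`, then no test has a sum of errors below `1 / C`. -/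
theorem one_le_mul_errorSum {Q₀ Q₁ : Measure X} [IsFiniteMeasure Q₀] [IsProbabilityMeasure Q₁]
    {C : ℝ} (hC : 1 ≤ C) (h : Q₁ ≤ ENNReal.ofReal C • Q₀) {φ : X → ℝ} (hφ : Measurable φ)
    (hφ' : ∀ x, φ x ∈ Set.Icc (0 : ℝ) 1) : 1 ≤ C * errorSum Q₀ Q₁ φ := by
  have hb : ∀ x, ‖φ x‖ ≤ 1 := fun x => by
    rw [Real.norm_of_nonneg (hφ' x).1]
    exact (hφ' x).2
  have h0 : Integrable φ Q₀ := .of_bound hφ.aestronglyMeasurable 1 (ae_of_all _ hb)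
  have h1 : Integrable φ Q₁ := .of_bound hφ.aestronglyMeasurable 1 (ae_of_all _ hb)
  have h2 : ∫ x, φ x ∂Q₁ ≤ C * ∫ x, φ x ∂Q₀ := by
    have := integral_mono_measure h (ae_of_all _ fun x => (hφ' x).1)
      (h0.smul_measure ENNReal.ofReal_ne_top)
    rwa [integral_smul_measure, ENNReal.toReal_ofReal (by linarith), smul_eq_mul] at this
  have h3 : (0 : ℝ) ≤ ∫ x, (1 - φ x) ∂Q₁ :=
    integral_nonneg fun x => sub_nonneg.2 (hφ' x).2
  have h4 : ∫ x, (1 - φ x) ∂Q₁ = 1 - ∫ x, φ x ∂Q₁ := by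
    rw [integral_sub (integrable_const _) h1]
    simp
  rw [errorSum]
  nlinarith

end Tests

/-! ### Sampling proportionally to weights. -/

section WeightedChoice

variable {n : ℕ}

theorem weightedChoice_apply {w : Fin (n + 1) → ℝ} (hw : ∀ v, 0 < w v) (v : Fin (n + 1)) :
    weightedChoice w v = ENNReal.ofReal (w v / ∑ v', w v') := by
  rw [weightedChoice, dif_pos hw, PMF.ofFintype_apply]

theorem expect_weightedChoice {w : Fin (n + 1) → ℝ} (hw : ∀ v, 0 < w v) (f : Fin (n + 1) → ℝ) :
    (weightedChoice w).expect f = (∑ v, w v * f v) / ∑ v, w v := by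
  have hs : 0 < ∑ v, w v := Finset.sum_pos (fun v _ => hw v) Finset.univ_nonempty
  rw [PMF.expect_eq_sum (s := Finset.univ) (by simp), Finset.sum_div]
  refine Finset.sum_congr rfl fun v _ => ?_
  rw [weightedChoice_apply hw, ENNReal.toReal_ofReal (div_pos (hw v) hs).le]
  ring

/-- One factor `K` comes from the numerator, the other from the normalizing sum. -/
theorem weightedChoice_le_mul {w w' : Fin (n + 1) → ℝ} (hw : ∀ v, 0 < w v) (hw' : ∀ v, 0 < w' v)
    {K : ℝ} (h : ∀ v, w v ≤ K * w' v) (h' : ∀ v, w' v ≤ K * w v) (v : Fin (n + 1)) :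
    weightedChoice w v ≤ ENNReal.ofReal (K ^ 2) * weightedChoice w' v := by
  have hs : 0 < ∑ v, w v := Finset.sum_pos (fun v _ => hw v) Finset.univ_nonempty
  have hs' : 0 < ∑ v, w' v := Finset.sum_pos (fun v _ => hw' v) Finset.univ_nonempty
  have hss : ∑ v, w' v ≤ K * ∑ v, w v := by
    rw [Finset.mul_sum]
    exact Finset.sum_le_sum fun v _ => h' v
  have hK : 0 < K := pos_of_mul_pos_left ((hw v).trans_le (h v)) (hw' v).le
  rw [weightedChoice_apply hw, weightedChoice_apply hw', ← ENNReal.ofReal_mul (by positivity)]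
  refine ENNReal.ofReal_le_ofReal ?_
  rw [div_le_iff₀ hs]
  calc w v ≤ K * w' v * 1 := by rw [mul_one]; exact h v
    _ ≤ K * w' v * (K * (∑ v, w v) / ∑ v, w' v) :=
        mul_le_mul_of_nonneg_left ((one_le_div hs').2 hss) (mul_pos hK (hw' v)).le
    _ = _ := by ring

end WeightedChoice

/-! ### One time step: Pólya urn means and bounded likelihood ratio. -/

section AttachEdges

open LabeledGraph

variable {n : ℕ}

theorem support_attachEdges_finite (d : ℝ) (G : LabeledGraph (n + 1)) (i : ℕ) :
    (attachEdges d G i).support.Finite := by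
  induction i with
  | zero => simp [attachEdges]
  | succ i ih =>
    refine PMF.support_bind_finite ih fun G' => ?_
    rw [PMF.support_map]
    exact (Set.toFinite _).image _

theorem isExtension_of_mem_support_attachEdges {d : ℝ} {G : LabeledGraph n} {i : ℕ} :
    ∀ {H : LabeledGraph (n + 1)}, H ∈ (attachEdges d G.addVertex i).support →
      IsExtension G i H := by
  induction i with
  | zero =>
    intro H hH
    rw [attachEdges, PMF.mem_support_pure_iff] at hH
    exact hH ▸ G.isExtension_addVertex
  | succ i ih =>
    intro H hH
    rw [attachEdges, PMF.mem_support_bind_iff] at hH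
    obtain ⟨H', hH', hH⟩ := hH
    obtain ⟨v, -, rfl⟩ := (PMF.mem_support_map_iff _ _ _).1 hH
    exact (ih hH').addEdge v

/-- The sum of the attachment weights of a graph on `{0, …, n}` before the first edge from the
next vertex is added. -/
def totalWeight (m : ℕ) (d : ℝ) (n : ℕ) : ℝ := 2 * m * n + (n + 1) * d

theorem LabeledGraph.IsExtension.weight_pos {m : ℕ} {d : ℝ} (hd : -(m : ℝ) < d)
    {G : LabeledGraph n} (hG : G.IsGood m) {i : ℕ} {H : LabeledGraph (n + 1)}
    (h : IsExtension G i H) (v : Fin (n + 1)) : 0 < (H.degree v.castSucc : ℝ) + d := by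
  have : (m : ℝ) ≤ H.degree v.castSucc := by exact_mod_cast (hG.2 v).trans (h.degree_le v)
  linarith

theorem LabeledGraph.IsExtension.sum_weight {m : ℕ} (d : ℝ)
    {G : LabeledGraph n} (hG : G.IsGood m) {i : ℕ} {H : LabeledGraph (n + 1)}
    (h : IsExtension G i H) :
    ∑ v : Fin (n + 1), ((H.degree v.castSucc : ℝ) + d) = totalWeight m d n + i := by
  have h1 : (∑ v : Fin (n + 1), (H.degree v.castSucc : ℝ)) = 2 * m * n + i := by
    exact_mod_cast h.sum_degree.trans (by rw [hG.1])
  rw [Finset.sum_add_distrib, h1, totalWeight]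
  simp
  ring

theorem totalWeight_pos {m : ℕ} {d : ℝ} (hd : -(m : ℝ) < d) (hn : 1 ≤ n) :
    0 < totalWeight m d n := by
  have hn' : (1 : ℝ) ≤ n := by exact_mod_cast hn
  have hm : (0 : ℝ) ≤ m := Nat.cast_nonneg m
  rw [totalWeight]
  nlinarith

/-- The expected sum of the degrees over a set of vertices evolves as in a Pólya urn. -/
theorem expect_attachEdges_sum_degree {m : ℕ} {d : ℝ} (hd : -(m : ℝ) < d) (hn : 1 ≤ n)
    {G : LabeledGraph n} (hG : G.IsGood m) (A : Finset (Fin (n + 1))) (i : ℕ) :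
    (attachEdges d G.addVertex i).expect (fun H => ∑ v ∈ A, ((H.degree v.castSucc : ℝ) + d)) =
      (∑ v ∈ A, ((G.degree v : ℝ) + d)) * ((totalWeight m d n + i) / totalWeight m d n) := by
  have hS := totalWeight_pos (m := m) hd hn
  induction i with
  | zero =>
    simp [attachEdges, PMF.expect_pure, degree_addVertex_castSucc, hS.ne']
  | succ i ih =>
    have hSi : 0 < totalWeight m d n + i := by positivity
    rw [attachEdges, PMF.expect_bind (support_attachEdges_finite _ _ _) fun G' => by
      rw [PMF.support_map]
      exact (Set.toFinite _).image _]
    -- With current total weight `S = totalWeight m d n + i`, the next edge adds to `A` on average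
    -- its weight divided by `S`. The factors `(S + 1) / S` telescope.
    rw [PMF.expect_congr (g := fun H => (totalWeight m d n + i + 1) / (totalWeight m d n + i) *
      ∑ v ∈ A, ((H.degree v.castSucc : ℝ) + d)), PMF.expect_const_mul, ih]
    · push_cast
      field_simp
      ring
    · intro H hH
      have hext := isExtension_of_mem_support_attachEdges hH
      have h1 : ∀ v, ∑ u ∈ A, (((H.addEdge v).degree u.castSucc : ℝ) + d) =
          (∑ u ∈ A, ((H.degree u.castSucc : ℝ) + d)) + if v ∈ A then 1 else 0 := by
        intro v
        simp only [degree_addEdge_castSucc, Nat.cast_add, add_right_comm _ _ d, Nat.cast_ite,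
          Nat.cast_one, Nat.cast_zero]
        rw [Finset.sum_add_distrib, Finset.sum_ite_eq']
      have h2 : ∀ (w : Fin (n + 1) → ℝ) (b : ℝ), ∑ v, w v * (b + if v ∈ A then 1 else 0) =
          (∑ v, w v) * b + ∑ v ∈ A, w v := by
        intro w b
        simp only [mul_add, mul_ite, mul_one, mul_zero, Finset.sum_add_distrib, ← Finset.sum_mul,
          Finset.sum_ite_mem, Finset.univ_inter]
      rw [PMF.expect_map (Set.toFinite _), expect_weightedChoice (hext.weight_pos hd hG),
        hext.sum_weight d hG]
      simp only [h1, h2]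
      rw [hext.sum_weight d hG]
      field_simp

/-- The conditional mean of the number of hits. -/
theorem expect_hits {m : ℕ} {d : ℝ} (hd : -(m : ℝ) < d) (hn : 1 ≤ n) {G : LabeledGraph n}
    (hG : G.IsGood m) :
    (attachEdges d G.addVertex m).expect (hits m) =
      m * (m + d) / totalWeight m d n * (G.verticesOfDegree m).card := by
  have hS := totalWeight_pos (m := m) hd hn
  -- Hits are the increase of the weight of the fixed set of degree-`m` vertices of `G`, so the urn
  -- identity applies.
  have h1 : ∀ H ∈ (attachEdges d G.addVertex m).support, hits m H =
      (∑ v ∈ G.verticesOfDegree m, ((H.degree v.castSucc : ℝ) + d)) +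
        -((m + d) * (G.verticesOfDegree m).card) := by
    intro H hH
    rw [hits, (isExtension_of_mem_support_attachEdges hH).restrict_eq]
    simp only [Finset.sum_add_distrib, Finset.sum_sub_distrib, Finset.sum_const, nsmul_eq_mul]
    ring
  have h2 : ∑ v ∈ G.verticesOfDegree m, ((G.degree v : ℝ) + d) =
      (m + d) * (G.verticesOfDegree m).card := by
    rw [Finset.sum_congr rfl fun v hv => by rw [(Finset.mem_filter.1 hv).2], Finset.sum_const,
      nsmul_eq_mul, mul_comm]
  have hfin := support_attachEdges_finite d G.addVertex m
  rw [PMF.expect_congr h1, PMF.expect_add hfin, PMF.expect_const hfin,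
    expect_attachEdges_sum_degree hd hn hG, h2]
  field_simp
  ring

theorem attachEdges_le_mul {m : ℕ} {d d' : ℝ} (hd : -(m : ℝ) < d) (hd' : -(m : ℝ) < d') {K : ℝ}
    (h : ∀ k : ℕ, m ≤ k → (k : ℝ) + d ≤ K * (k + d'))
    (h' : ∀ k : ℕ, m ≤ k → (k : ℝ) + d' ≤ K * (k + d))
    {G : LabeledGraph n} (hG : G.IsGood m) (i : ℕ) :
    ∀ H, attachEdges d G.addVertex i H ≤
      ENNReal.ofReal (K ^ 2) ^ i * attachEdges d' G.addVertex i H := by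
  induction i with
  | zero => simp [attachEdges]
  | succ i ih =>
    rw [pow_succ]
    refine PMF.bind_le_mul_bind ih fun H hH => PMF.map_le_mul_map ?_ _
    have hext := isExtension_of_mem_support_attachEdges hH
    exact weightedChoice_le_mul (hext.weight_pos hd hG) (hext.weight_pos hd' hG)
      (fun v => h _ ((hG.2 v).trans (hext.degree_le v)))
      (fun v => h' _ ((hG.2 v).trans (hext.degree_le v)))

end AttachEdges

/-! ### The whole graph process and its likelihood ratio. -/

section PrefAttachLaw

open LabeledGraph

theorem support_prefAttachLaw_finite (m : ℕ) (δ : ℕ → ℝ) :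
    ∀ n, (prefAttachLaw m δ n).support.Finite
  | 0 => by simp [prefAttachLaw]
  | 1 => by simp [prefAttachLaw]
  | n + 2 => PMF.support_bind_finite (support_prefAttachLaw_finite m δ (n + 1))
      fun _ => support_attachEdges_finite _ _ _

theorem isGood_iterate_addEdge (m : ℕ) :
    ((fun G : LabeledGraph 1 => G.addEdge 0)^[m] (edgeless 1)).IsGood m := by
  have h : ∀ i v, ((fun G : LabeledGraph 1 => G.addEdge 0)^[i] (edgeless 1)).degree v = i := by
    intro i
    induction i with
    | zero => simp [edgeless, degree, inDegree, outDegree]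
    | succ i ih =>
      intro v
      rw [Function.iterate_succ_apply']
      induction v using Fin.lastCases with
      | last => rw [degree_addEdge_last, ih]
      | cast v => rw [degree_addEdge_castSucc, ih, if_pos (Subsingleton.elim (α := Fin 1) _ _)]
  refine ⟨?_, fun v => (h m v).ge⟩
  simp [h]

theorem isGood_of_mem_support_prefAttachLaw {m : ℕ} {δ : ℕ → ℝ} :
    ∀ {n : ℕ} {G : LabeledGraph (n + 1)}, G ∈ (prefAttachLaw m δ (n + 1)).support → G.IsGood m
  | 0, G, hG => by
    rw [prefAttachLaw, PMF.mem_support_pure_iff] at hG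
    exact hG ▸ isGood_iterate_addEdge m
  | n + 1, G, hG => by
    rw [prefAttachLaw, PMF.mem_support_bind_iff] at hG
    obtain ⟨G', hG', hG⟩ := hG
    exact (isExtension_of_mem_support_attachEdges hG).isGood
      (isGood_of_mem_support_prefAttachLaw hG')

theorem expect_prefAttachLaw_succ (m : ℕ) (δ : ℕ → ℝ) {n : ℕ} (hn : 1 ≤ n)
    (f : LabeledGraph (n + 1) → ℝ) :
    (prefAttachLaw m δ (n + 1)).expect f = (prefAttachLaw m δ n).expect fun G =>
      (attachEdges (δ (n + 1)) G.addVertex m).expect f := by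
  obtain ⟨n, rfl⟩ := Nat.exists_eq_add_of_le' hn
  exact PMF.expect_bind (support_prefAttachLaw_finite m δ (n + 1))
    (fun _ => support_attachEdges_finite _ _ _) f

/-- The likelihood ratio is bounded in terms of the number of steps after the change. -/
theorem prefAttachLaw_changeParam_le {m : ℕ} {δ₀ δ₁ : ℝ} (hδ₀ : -(m : ℝ) < δ₀)
    (hδ₁ : -(m : ℝ) < δ₁) {K : ℝ} (hK : 1 ≤ K)
    (h : ∀ k : ℕ, m ≤ k → (k : ℝ) + δ₁ ≤ K * (k + δ₀))
    (h' : ∀ k : ℕ, m ≤ k → (k : ℝ) + δ₀ ≤ K * (k + δ₁)) (τ : ℕ) :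
    ∀ n G, prefAttachLaw m (changeParam δ₀ δ₁ τ) n G ≤
      (ENNReal.ofReal (K ^ 2) ^ m) ^ (n - τ) * prefAttachLaw m (fun _ => δ₀) n G
  | 0, G => by simp [prefAttachLaw]
  -- `G_1` has the same law under both hypotheses; the factor is `1` or, when `τ = 0`, a number at
  -- least `1`.
  | 1, G => le_mul_of_one_le_left' (by
      refine one_le_pow₀ (one_le_pow₀ ?_)
      rw [← ENNReal.ofReal_one]
      exact ENNReal.ofReal_le_ofReal (one_le_pow₀ hK))
  | n + 2, G => by
    have ih := prefAttachLaw_changeParam_le hδ₀ hδ₁ hK h h' τ (n + 1)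
    rw [prefAttachLaw, prefAttachLaw]
    by_cases ht : n + 2 ≤ τ
    · have h1 : changeParam δ₀ δ₁ τ (n + 2) = δ₀ := if_pos ht
      rw [show n + 2 - τ = n + 1 - τ by omega, h1, ← mul_one (_ ^ (n + 1 - τ))]
      exact PMF.bind_le_mul_bind ih (fun _ _ H => by rw [one_mul]) G
    · have h1 : changeParam δ₀ δ₁ τ (n + 2) = δ₁ := if_neg ht
      rw [show n + 2 - τ = (n + 1 - τ) + 1 by omega, h1, pow_succ]
      exact PMF.bind_le_mul_bind ih (fun G' hG' H => attachEdges_le_mul hδ₁ hδ₀ h h'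
        (isGood_of_mem_support_prefAttachLaw hG') m H) G

end PrefAttachLaw

/-! ### Sums along the history and their moments. -/

open LabeledGraph

/-- The sum of `f k` over the successive restrictions of a graph on `{0, …, n}` to
`{0, …, k + 1}`, where `k < n`. -/
def pathSum (f : ∀ n, LabeledGraph (n + 1) → ℝ) : ∀ n, LabeledGraph n → ℝ
  | 0, _ => 0
  | n + 1, H => pathSum f n H.restrict + f n H

theorem pathSum_eq_zero {f : ∀ n, LabeledGraph (n + 1) → ℝ} {τ : ℕ}
    (hf : ∀ n, n < τ → ∀ H, f n H = 0) : ∀ n, n ≤ τ → ∀ G, pathSum f n G = 0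
  | 0, _, _ => rfl
  | n + 1, hn, G => by
    rw [pathSum, pathSum_eq_zero hf n (by omega), hf n hn, add_zero]

section Moments

variable {m : ℕ} {δ : ℕ → ℝ}

theorem expect_prefAttachLaw_restrict {n : ℕ} (hn : 1 ≤ n) (F : LabeledGraph n → ℝ) :
    (prefAttachLaw m δ (n + 1)).expect (fun H => F H.restrict) =
      (prefAttachLaw m δ n).expect F := by
  rw [expect_prefAttachLaw_succ m δ hn]
  refine PMF.expect_congr fun G _ => ?_
  rw [PMF.expect_congr (g := fun _ => F G), PMF.expect_const (support_attachEdges_finite _ _ _)]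
  exact fun H hH => by rw [(isExtension_of_mem_support_attachEdges hH).restrict_eq]

theorem isGood_of_mem_support_prefAttachLaw' {n : ℕ} (hn : 1 ≤ n) {G : LabeledGraph n}
    (hG : G ∈ (prefAttachLaw m δ n).support) : G.IsGood m := by
  obtain ⟨n, rfl⟩ := Nat.exists_eq_add_of_le' hn
  exact isGood_of_mem_support_prefAttachLaw hG

/-- Second moment of a martingale with increments in `L²`. -/
theorem expect_sq_pathSum_le {f : ∀ n, LabeledGraph (n + 1) → ℝ} {τ : ℕ} {K : ℝ} (hτ : 1 ≤ τ)
    (h0 : ∀ n, n < τ → ∀ H, f n H = 0)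
    (hmean : ∀ n, τ ≤ n → ∀ G : LabeledGraph n, G.IsGood m →
      (attachEdges (δ (n + 1)) G.addVertex m).expect (f n) = 0)
    (hsq : ∀ n, τ ≤ n → ∀ G : LabeledGraph n, G.IsGood m →
      (attachEdges (δ (n + 1)) G.addVertex m).expect (fun H => f n H ^ 2) ≤ K) (n : ℕ) :
    (prefAttachLaw m δ n).expect (fun G => pathSum f n G ^ 2) ≤ K * (n - τ : ℕ) := by
  induction n with
  | zero => simp [pathSum, PMF.expect]
  | succ n ih =>
    rcases lt_or_ge n τ with hn | hn
    · simp [pathSum_eq_zero h0 (n + 1) hn, PMF.expect, show n + 1 - τ = 0 by omega]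
    · have h1 : 1 ≤ n := hτ.trans hn
      have h2 : ((n + 1 - τ : ℕ) : ℝ) = (n - τ : ℕ) + 1 := by
        rw [Nat.sub_add_comm hn, Nat.cast_add_one]
      have h3 : ∀ G ∈ (prefAttachLaw m δ n).support,
          (attachEdges (δ (n + 1)) G.addVertex m).expect (fun H => pathSum f (n + 1) H ^ 2) ≤
            pathSum f n G ^ 2 + K := by
        intro G hG
        have hG' := isGood_of_mem_support_prefAttachLaw' h1 hG
        have hfin := support_attachEdges_finite (δ (n + 1)) G.addVertex m
        have h4 : ∀ H ∈ (attachEdges (δ (n + 1)) G.addVertex m).support,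
            pathSum f (n + 1) H ^ 2 =
              pathSum f n G ^ 2 + (2 * pathSum f n G * f n H + f n H ^ 2) := by
          intro H hH
          rw [pathSum, (isExtension_of_mem_support_attachEdges hH).restrict_eq]
          ring
        -- The cross term vanishes because the past sum is constant given `G` and the increment has
        -- conditional mean zero.
        rw [PMF.expect_congr h4, PMF.expect_add hfin, PMF.expect_const hfin, PMF.expect_add hfin,
          PMF.expect_const_mul, hmean n hn G hG', mul_zero, zero_add]
        exact add_le_add_right (hsq n hn G hG') _
      have hfin := support_prefAttachLaw_finite m δ n
      rw [expect_prefAttachLaw_succ m δ h1, h2]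
      refine (PMF.expect_mono hfin h3).trans ?_
      rw [PMF.expect_add hfin, PMF.expect_const hfin]
      linarith

/-- The hits after time `τ`, centered by their conditional means under the parameter `d`. -/
noncomputable def centeredHits (m : ℕ) (d : ℝ) (τ n : ℕ) (H : LabeledGraph (n + 1)) : ℝ :=
  if n < τ then 0 else
    hits m H - m * (m + d) / totalWeight m d n * (H.restrict.verticesOfDegree m).card

/-- Vertex `n + 1` attaches with parameter `δ (n + 1)`, so the steps after the change are those with
`n ≥ τ`. There hits and their mean both lie in `[0, m]`, so a squared increment is at most `m²`. -/
theorem expect_sq_pathSum_centeredHits_le {d : ℝ} (hd : -(m : ℝ) < d) {τ : ℕ} (hτ : 1 ≤ τ)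
    (hδ : ∀ t, τ < t → δ t = d) (n : ℕ) :
    (prefAttachLaw m δ n).expect (fun G => pathSum (centeredHits m d τ) n G ^ 2) ≤
      (m : ℝ) ^ 2 * (n - τ : ℕ) := by
  have key : ∀ n, τ ≤ n → ∀ G : LabeledGraph n,
      ∀ H ∈ (attachEdges (δ (n + 1)) G.addVertex m).support, centeredHits m d τ n H =
        hits m H + -(m * (m + d) / totalWeight m d n * (G.verticesOfDegree m).card) := by
    intro n hn G H hH
    rw [centeredHits, if_neg (by omega), (isExtension_of_mem_support_attachEdges hH).restrict_eq]
    ring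
  refine expect_sq_pathSum_le (f := centeredHits m d τ) hτ (fun n hn H => if_pos hn) ?_ ?_ n
  · intro n hn G hG
    have hfin := support_attachEdges_finite (δ (n + 1)) G.addVertex m
    rw [PMF.expect_congr (key n hn G), PMF.expect_add hfin, PMF.expect_const hfin,
      hδ (n + 1) (by omega), expect_hits hd (by omega) hG, add_neg_cancel]
  · intro n hn G hG
    have hfin := support_attachEdges_finite (δ (n + 1)) G.addVertex m
    set μ := m * (m + d) / totalWeight m d n * (G.verticesOfDegree m).card with hμ
    have hmean : (attachEdges (δ (n + 1)) G.addVertex m).expect (hits m) = μ := by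
      rw [hδ (n + 1) (by omega), expect_hits hd (by omega) hG]
    have h0 : 0 ≤ μ := by
      rw [← hmean, ← PMF.expect_const hfin 0]
      exact PMF.expect_mono hfin fun H hH =>
        (isExtension_of_mem_support_attachEdges hH).hits_nonneg hG
    have h1 : μ ≤ m := by
      rw [← hmean, ← PMF.expect_const hfin m]
      exact PMF.expect_mono hfin fun H hH =>
        (isExtension_of_mem_support_attachEdges hH).hits_le
    rw [← PMF.expect_const hfin ((m : ℝ) ^ 2)]
    refine PMF.expect_mono hfin fun H hH => ?_
    have h2 := (isExtension_of_mem_support_attachEdges hH).hits_nonneg hG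
    have h3 := (isExtension_of_mem_support_attachEdges hH).hits_le
    rw [key n hn G H hH]
    exact sq_le_sq' (by linarith) (by linarith)

/-- The amount by which the proportion of vertices of degree `m` falls short of `1 / (m + 1)`,
multiplied by `n`. -/
noncomputable def shortfall (m : ℕ) {n : ℕ} (G : LabeledGraph n) : ℝ :=
  max (n / (m + 1) - (G.verticesOfDegree m).card) 0

/-- A second-order expansion of the squared positive part, whose derivative is `2 * max x 0`. -/
theorem sq_max_add_le (x y : ℝ) : max (x + y) 0 ^ 2 ≤ max x 0 ^ 2 + 2 * max x 0 * y + y ^ 2 := by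
  rcases le_total x 0 with hx | hx <;> rcases le_total (x + y) 0 with hy | hy <;>
    simp only [max_eq_left, max_eq_right, hx, hy] <;> nlinarith [sq_nonneg (x + y)]

/-- Drift argument: whenever the shortfall is positive its mean increment is nonpositive, so only
the squared increment, at most `m²`, contributes. -/
theorem expect_sq_shortfall_attachEdges_le (hm : 1 ≤ m) {d : ℝ} (hd : -(m : ℝ) < d) {n : ℕ}
    (hn : 1 ≤ n) {G : LabeledGraph n} (hG : G.IsGood m) :
    (attachEdges d G.addVertex m).expect (fun H => shortfall m H ^ 2) ≤
      shortfall m G ^ 2 + (m : ℝ) ^ 2 := by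
  have hfin := support_attachEdges_finite d G.addVertex m
  have hm' : (1 : ℝ) ≤ m := by exact_mod_cast hm
  have hn' : (1 : ℝ) ≤ n := by exact_mod_cast hn
  have hS := totalWeight_pos (m := m) hd hn
  set c : ℝ := 1 / (m + 1) with hc
  have hc0 : 0 < c := by positivity
  have hcm : c * (m + 1) = 1 := by rw [hc]; field_simp
  set N : ℝ := ((G.verticesOfDegree m).card : ℝ) with hN
  have hN0 : 0 ≤ N := Nat.cast_nonneg _
  have hZ : shortfall m G = max (c * n - N) 0 := by rw [shortfall, hc, one_div_mul_eq_div]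
  have h1 : ∀ H ∈ (attachEdges d G.addVertex m).support, shortfall m H ^ 2 ≤
      shortfall m G ^ 2 + 2 * shortfall m G * (c - 1) + (m : ℝ) ^ 2 +
        2 * shortfall m G * hits m H := by
    intro H hH
    have hext := isExtension_of_mem_support_attachEdges hH
    have hX0 := hext.hits_nonneg hG
    have hX1 := hext.hits_le
    have hcard := hext.card_le hG
    have h2 : shortfall m H ≤ max ((c * n - N) + (c - 1 + hits m H)) 0 := by
      rw [shortfall]
      refine max_le_max ?_ le_rfl
      push_cast
      rw [← one_div_mul_eq_div, ← hc]
      linarith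
    have h3 : shortfall m H ^ 2 ≤ max ((c * n - N) + (c - 1 + hits m H)) 0 ^ 2 :=
      pow_le_pow_left₀ (le_max_right _ _) h2 2
    have h4 : (c - 1 + hits m H) ^ 2 ≤ (m : ℝ) ^ 2 :=
      sq_le_sq' (by linarith) (by nlinarith)
    have h5 := sq_max_add_le (c * n - N) (c - 1 + hits m H)
    rw [hZ]
    linarith
  refine (PMF.expect_mono hfin h1).trans ?_
  rw [PMF.expect_add hfin, PMF.expect_const hfin, PMF.expect_const_mul, expect_hits hd hn hG]
  suffices shortfall m G * (c - 1 + m * (m + d) / totalWeight m d n * N) ≤ 0 by linarith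
  rcases le_or_gt (c * n - N) 0 with hx | hx
  · rw [hZ, max_eq_right hx, zero_mul]
  · refine mul_nonpos_of_nonneg_of_nonpos (le_max_right _ _) ?_
    -- The difference is `m n + d`, nonnegative for every `d > -m`. With `N < c n` the mean number
    -- of hits is then at most `m c`, and `c = 1 / (m + 1)` is the value for which `c - 1 + m c =
    -- 0`. As `c` does not depend on `d`, the bound survives the change of parameter.
    have h6 : n * (m + d) ≤ totalWeight m d n := by
      rw [totalWeight]
      nlinarith
    have h7 : m * (m + d) / totalWeight m d n * N ≤ m * c := by
      rw [div_mul_eq_mul_div, div_le_iff₀ hS]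
      calc m * (m + d) * N ≤ m * (m + d) * (c * n) :=
            mul_le_mul_of_nonneg_left (by linarith) (mul_nonneg (by linarith) (by linarith))
        _ = m * c * (n * (m + d)) := by ring
        _ ≤ m * c * totalWeight m d n := mul_le_mul_of_nonneg_left h6 (by positivity)
    linarith

theorem expect_sq_shortfall_le (hm : 1 ≤ m) (hδ : ∀ t, -(m : ℝ) < δ t) {n : ℕ} (hn : 1 ≤ n) :
    (prefAttachLaw m δ n).expect (fun G => shortfall m G ^ 2) ≤ (m : ℝ) ^ 2 * n := by
  have hm' : (1 : ℝ) ≤ m := by exact_mod_cast hm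
  induction n, hn using Nat.le_induction with
  | base =>
    have hfin := support_prefAttachLaw_finite m δ 1
    rw [Nat.cast_one, mul_one, ← PMF.expect_const hfin ((m : ℝ) ^ 2)]
    refine PMF.expect_mono hfin fun G _ => pow_le_pow_left₀ (le_max_right _ _) ?_ 2
    refine max_le ?_ (by linarith)
    have h1 : ((1 : ℕ) : ℝ) / (m + 1) ≤ 1 := by
      rw [Nat.cast_one, div_le_one (by linarith)]
      linarith
    have h2 : (0 : ℝ) ≤ (G.verticesOfDegree m).card := Nat.cast_nonneg _
    linarith
  | succ n hn ih =>
    have hfin := support_prefAttachLaw_finite m δ n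
    rw [expect_prefAttachLaw_succ m δ hn]
    refine (PMF.expect_mono hfin fun G hG => expect_sq_shortfall_attachEdges_le hm (hδ (n + 1)) hn
      (isGood_of_mem_support_prefAttachLaw' hn hG)).trans ?_
    rw [PMF.expect_add hfin, PMF.expect_const hfin]
    push_cast
    linarith

/-- The squared relative shortfall before the last vertex is added, after time `τ`. -/
noncomputable def relativeShortfallSq (m τ n : ℕ) (H : LabeledGraph (n + 1)) : ℝ :=
  if n < τ then 0 else (1 / (n : ℝ) ^ 2) * shortfall m H.restrict ^ 2

/-- Each term has mean at most `m² / n ≤ m² / τ`; this is where a late change helps. -/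
theorem expect_pathSum_relativeShortfallSq_le (hm : 1 ≤ m) (hδ : ∀ t, -(m : ℝ) < δ t) {τ : ℕ}
    (hτ : 1 ≤ τ) (n : ℕ) :
    (prefAttachLaw m δ n).expect (pathSum (relativeShortfallSq m τ) n) ≤
      (m : ℝ) ^ 2 / τ * (n - τ : ℕ) := by
  induction n with
  | zero => simp [pathSum, PMF.expect]
  | succ n ih =>
    rcases lt_or_ge n τ with hn | hn
    · simp [pathSum_eq_zero (f := relativeShortfallSq m τ) (fun n hn H => if_pos hn) (n + 1) hn,
        PMF.expect, show n + 1 - τ = 0 by omega]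
    · have h1 : 1 ≤ n := hτ.trans hn
      have h2 : ((n + 1 - τ : ℕ) : ℝ) = (n - τ : ℕ) + 1 := by
        rw [Nat.sub_add_comm hn, Nat.cast_add_one]
      let F : LabeledGraph n → ℝ := fun G => pathSum (relativeShortfallSq m τ) n G +
        (1 / (n : ℝ) ^ 2) * shortfall m G ^ 2
      have h3 : pathSum (relativeShortfallSq m τ) (n + 1) = fun H => F H.restrict := by
        funext H
        rw [pathSum, relativeShortfallSq, if_neg (by omega)]
      have hfin' := support_prefAttachLaw_finite m δ n
      rw [h3, expect_prefAttachLaw_restrict h1 F, PMF.expect_add hfin',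
        PMF.expect_const_mul, h2]
      have h4 : (1 / (n : ℝ) ^ 2) * (prefAttachLaw m δ n).expect (fun G => shortfall m G ^ 2) ≤
          (m : ℝ) ^ 2 / τ := by
        have hn0 : (0 : ℝ) < n := by exact_mod_cast h1
        have hτ0 : (0 : ℝ) < τ := by exact_mod_cast hτ
        calc _ ≤ (1 / (n : ℝ) ^ 2) * ((m : ℝ) ^ 2 * n) :=
              mul_le_mul_of_nonneg_left (expect_sq_shortfall_le hm hδ h1) (by positivity)
          _ = (m : ℝ) ^ 2 / n := by field_simp
          _ ≤ (m : ℝ) ^ 2 / τ :=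
              div_le_div_of_nonneg_left (by positivity) hτ0 (by exact_mod_cast hn)
      linarith

end Moments

/-! ### The drift produced by the change. -/

section Separation

variable {m : ℕ} {δ₀ δ₁ : ℝ}

theorem totalWeight_le {d : ℝ} {n : ℕ} (hn : 1 ≤ n) {K : ℝ} (hK : 2 * m + 2 * |d| ≤ K) :
    totalWeight m d n ≤ K * n := by
  have hn' : (1 : ℝ) ≤ n := by exact_mod_cast hn
  have h1 : (n + 1) * d ≤ (n + n) * |d| :=
    (mul_le_mul_of_nonneg_left (le_abs_self d) (by linarith)).trans
      (mul_le_mul_of_nonneg_right (by linarith) (abs_nonneg d))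
  rw [totalWeight]
  nlinarith

/-- The difference of the conditional means of the hits under the two parameters. -/
theorem conditionalMean_sub (hδ₀ : -(m : ℝ) < δ₀) (hδ₁ : -(m : ℝ) < δ₁) {n : ℕ} (hn : 1 ≤ n) :
    m * (m + δ₁) / totalWeight m δ₁ n - m * (m + δ₀) / totalWeight m δ₀ n =
      (δ₁ - δ₀) * (m ^ 2 * (n - 1) / (totalWeight m δ₀ n * totalWeight m δ₁ n)) := by
  have h0 := totalWeight_pos (m := m) hδ₀ hn
  have h1 := totalWeight_pos (m := m) hδ₁ hn
  have h2 : (m + δ₁) * totalWeight m δ₀ n - (m + δ₀) * totalWeight m δ₁ n =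
      (δ₁ - δ₀) * (m * (n - 1)) := by
    simp only [totalWeight]
    ring
  rw [div_sub_div _ _ h1.ne' h0.ne', mul_div_assoc',
    mul_comm (totalWeight m δ₁ n) (totalWeight m δ₀ n)]
  congr 1
  linear_combination (m : ℝ) * h2

/-- The hits cancel, leaving the difference of conditional means. Multiplying by `δ₁ - δ₀` turns its
sign into a square, which treats both directions of change at once. -/
theorem le_centeredHits_sub (hm : 1 ≤ m) (hδ₀ : -(m : ℝ) < δ₀) (hδ₁ : -(m : ℝ) < δ₁) {K : ℝ}
    (hK₀ : 2 * m + 2 * |δ₀| ≤ K) (hK₁ : 2 * m + 2 * |δ₁| ≤ K) {τ : ℕ} (hτ : 2 ≤ τ) {n : ℕ}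
    (hn : τ ≤ n) (H : LabeledGraph (n + 1)) :
    (δ₁ - δ₀) ^ 2 * (m ^ 2 / (2 * K ^ 2)) *
        (3 / (4 * (m + 1)) - (m + 1) * relativeShortfallSq m τ n H) ≤
      (δ₁ - δ₀) * (centeredHits m δ₀ τ n H - centeredHits m δ₁ τ n H) := by
  have hm' : (1 : ℝ) ≤ m := by exact_mod_cast hm
  have hn' : (2 : ℝ) ≤ n := by exact_mod_cast hτ.trans hn
  have hK : 0 < K := lt_of_lt_of_le (by positivity) hK₀
  have h0 := totalWeight_pos (m := m) (n := n) hδ₀ (by omega)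
  have h1 := totalWeight_pos (m := m) (n := n) hδ₁ (by omega)
  set N : ℝ := ((H.restrict.verticesOfDegree m).card : ℝ) with hN
  have hN0 : 0 ≤ N := Nat.cast_nonneg _
  set Z := shortfall m H.restrict with hZ
  have hNZ : 1 / ((m : ℝ) + 1) - Z / n ≤ N / n := by
    have h : (n : ℝ) / (m + 1) - N ≤ Z := le_max_left _ _
    rw [sub_le_iff_le_add, ← add_div, le_div_iff₀ (by linarith), one_div_mul_eq_div]
    linarith
  -- Weighted AM-GM replaces the shortfall by its square, whose mean is controlled, and costs a
  -- quarter of `1 / (m + 1)`.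
  have hZsq : Z / n ≤ (m + 1) * (Z / n) ^ 2 + 1 / (4 * (m + 1)) := by
    have h : 0 ≤ (m + 1) * (Z / n - 1 / (2 * (m + 1))) ^ 2 := by positivity
    have h' : (m + 1) * (Z / n - 1 / (2 * (m + 1))) ^ 2 =
        (m + 1) * (Z / n) ^ 2 - Z / n + 1 / (4 * ((m : ℝ) + 1)) := by
      field_simp
      ring
    linarith
  have hlow : 3 / (4 * ((m : ℝ) + 1)) - (m + 1) * relativeShortfallSq m τ n H ≤ N / n := by
    have h : 3 / (4 * ((m : ℝ) + 1)) = 1 / (m + 1) - 1 / (4 * (m + 1)) := by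
      field_simp
      norm_num
    rw [relativeShortfallSq, if_neg (by omega), ← hZ, one_div_mul_eq_div, ← div_pow, h]
    linarith
  -- The bound `n - 1 ≥ n / 2` needs `n ≥ 2`, hence `2 ≤ τ`; at `n = 1` the conditional means agree.
  have hcoef : m ^ 2 / (2 * K ^ 2) * (1 / n) ≤
      m ^ 2 * (n - 1) / (totalWeight m δ₀ n * totalWeight m δ₁ n) := by
    calc m ^ 2 / (2 * K ^ 2) * (1 / n) = m ^ 2 * (n / 2) / ((K * n) * (K * n)) := by
          field_simp
      _ ≤ _ := div_le_div₀ (mul_nonneg (sq_nonneg _) (by linarith))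
          (mul_le_mul_of_nonneg_left (by linarith) (sq_nonneg _)) (mul_pos h0 h1)
          (mul_le_mul (totalWeight_le (by omega) hK₀) (totalWeight_le (by omega) hK₁) h1.le
            (by positivity))
  have hdiff : centeredHits m δ₀ τ n H - centeredHits m δ₁ τ n H =
      (δ₁ - δ₀) * (m ^ 2 * (n - 1) / (totalWeight m δ₀ n * totalWeight m δ₁ n)) * N := by
    rw [← conditionalMean_sub hδ₀ hδ₁ (by omega), centeredHits, centeredHits, if_neg (by omega),
      if_neg (by omega)]
    ring
  calc _ ≤ (δ₁ - δ₀) ^ 2 * (m ^ 2 / (2 * K ^ 2)) * (N / n) :=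
        mul_le_mul_of_nonneg_left hlow (by positivity)
    _ = (δ₁ - δ₀) ^ 2 * N * (m ^ 2 / (2 * K ^ 2) * (1 / n)) := by ring
    _ ≤ (δ₁ - δ₀) ^ 2 * N * (m ^ 2 * (n - 1) / (totalWeight m δ₀ n * totalWeight m δ₁ n)) :=
        mul_le_mul_of_nonneg_left hcoef (by positivity)
    _ = _ := by
        rw [hdiff]
        ring

theorem le_pathSum_centeredHits_sub (hm : 1 ≤ m) (hδ₀ : -(m : ℝ) < δ₀) (hδ₁ : -(m : ℝ) < δ₁)
    {K : ℝ} (hK₀ : 2 * m + 2 * |δ₀| ≤ K) (hK₁ : 2 * m + 2 * |δ₁| ≤ K) {τ : ℕ} (hτ : 2 ≤ τ)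
    (n : ℕ) (G : LabeledGraph n) :
    (δ₁ - δ₀) ^ 2 * (m ^ 2 / (2 * K ^ 2)) *
        (3 / (4 * (m + 1)) * (n - τ : ℕ) - (m + 1) * pathSum (relativeShortfallSq m τ) n G) ≤
      (δ₁ - δ₀) * (pathSum (centeredHits m δ₀ τ) n G - pathSum (centeredHits m δ₁ τ) n G) := by
  induction n with
  | zero => simp [pathSum]
  | succ n ih =>
    rcases lt_or_ge n τ with hn | hn
    · rw [
        pathSum_eq_zero (f := relativeShortfallSq m τ) (fun n hn H => if_pos hn) (n + 1) hn,
        pathSum_eq_zero (f := centeredHits m δ₀ τ) (fun n hn H => if_pos hn) (n + 1) hn,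
        pathSum_eq_zero (f := centeredHits m δ₁ τ) (fun n hn H => if_pos hn) (n + 1) hn,
        show n + 1 - τ = 0 by omega]
      simp
    · have h2 : ((n + 1 - τ : ℕ) : ℝ) = (n - τ : ℕ) + 1 := by
        rw [Nat.sub_add_comm hn, Nat.cast_add_one]
      have h3 := ih G.restrict
      have h4 := le_centeredHits_sub hm hδ₀ hδ₁ hK₀ hK₁ hτ hn G
      simp only [pathSum, h2]
      linarith

end Separation

/-! ### Error bounds and the threshold. -/

section Detection

variable {m : ℕ} {δ₀ δ₁ : ℝ}

theorem neg_lt_changeParam (hδ₀ : -(m : ℝ) < δ₀) (hδ₁ : -(m : ℝ) < δ₁) (τ t : ℕ) :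
    -(m : ℝ) < changeParam δ₀ δ₁ τ t := by
  unfold changeParam
  split_ifs <;> assumption

/-- The likelihood ratio is at most `C ^ (n - τ)` for a constant `C`. -/
theorem exists_altLaw_le (hδ₀ : -(m : ℝ) < δ₀) (hδ₁ : -(m : ℝ) < δ₁) :
    ∃ C : ℝ, 1 ≤ C ∧ ∀ τ n,
      altLaw m δ₀ δ₁ τ n ≤ ENNReal.ofReal (C ^ (n - τ)) • nullLaw m δ₀ n := by
  have key : ∀ a b : ℝ, -(m : ℝ) < a → ∀ k : ℕ, m ≤ k →
      (k : ℝ) + b ≤ (1 + |b - a| / (m + a)) * (k + a) := by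
    intro a b ha k hk
    have hk' : (m : ℝ) ≤ k := by exact_mod_cast hk
    have ha' : 0 < m + a := by linarith
    have h1 : |b - a| ≤ |b - a| / (m + a) * (k + a) := by
      rw [div_mul_eq_mul_div, le_div_iff₀ ha']
      exact mul_le_mul_of_nonneg_left (by linarith) (abs_nonneg _)
    have h2 := le_abs_self (b - a)
    linarith
  -- The ratio `(k + b) / (k + a) = 1 + (b - a) / (k + a)` is largest in deviation at `k = m`.
  set K : ℝ := max (1 + |δ₁ - δ₀| / (m + δ₀)) (1 + |δ₀ - δ₁| / (m + δ₁)) with hK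
  have h0 : 0 < m + δ₀ := by linarith
  have hK1 : 1 ≤ K := le_max_of_le_left (le_add_of_nonneg_right (by positivity))
  have hle : ∀ a b : ℝ, -(m : ℝ) < a → 1 + |b - a| / (m + a) ≤ K → ∀ k : ℕ, m ≤ k →
      (k : ℝ) + b ≤ K * (k + a) := fun a b ha hKab k hk =>
    (key a b ha k hk).trans (mul_le_mul_of_nonneg_right hKab (by
      have hk' : (m : ℝ) ≤ k := by exact_mod_cast hk
      linarith))
  refine ⟨(K ^ 2) ^ m, one_le_pow₀ (one_le_pow₀ hK1), fun τ n => PMF.toMeasure_le_smul fun G => ?_⟩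
  have h := prefAttachLaw_changeParam_le hδ₀ hδ₁ hK1 (hle _ _ hδ₀ (le_max_left _ _))
    (hle _ _ hδ₁ (le_max_right _ _)) τ n G
  rwa [← ENNReal.ofReal_pow (by positivity), ← ENNReal.ofReal_pow (by positivity)] at h

instance (n : ℕ) : IsProbabilityMeasure (nullLaw m δ₀ n) := by
  unfold nullLaw
  infer_instance

instance (τ n : ℕ) : IsProbabilityMeasure (altLaw m δ₀ δ₁ τ n) := by
  unfold altLaw
  infer_instance

theorem altLaw_absolutelyContinuous (hδ₀ : -(m : ℝ) < δ₀) (hδ₁ : -(m : ℝ) < δ₁) (τ n : ℕ) :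
    altLaw m δ₀ δ₁ τ n ≪ nullLaw m δ₀ n := by
  obtain ⟨C, -, h⟩ := exists_altLaw_le hδ₀ hδ₁
  exact Measure.absolutelyContinuous_of_le_smul (h τ n)

/-- A test based on the hits after the change has a small sum of errors. -/
theorem exists_errorSum_le (hm : 1 ≤ m) (hδ₀ : -(m : ℝ) < δ₀) (hδ₁ : -(m : ℝ) < δ₁)
    (hne : δ₀ ≠ δ₁) : ∃ A B : ℝ, ∀ τ n, 2 ≤ τ → τ < n → ∃ φ : LabeledGraph n → ℝ,
      (∀ G, φ G ∈ Set.Icc (0 : ℝ) 1) ∧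
      errorSum (nullLaw m δ₀ n) (altLaw m δ₀ δ₁ τ n) φ ≤ A / (n - τ : ℕ) + B / τ := by
  classical
  have hm' : (1 : ℝ) ≤ m := by exact_mod_cast hm
  set s : ℝ := δ₁ - δ₀ with hs
  have hs0 : 0 < s ^ 2 := by
    have : s ≠ 0 := sub_ne_zero.2 hne.symm
    positivity
  set K : ℝ := 2 * m + 2 * |δ₀| + 2 * |δ₁| with hK
  have hK₀ : 2 * m + 2 * |δ₀| ≤ K := by linarith [abs_nonneg δ₁]
  have hK₁ : 2 * m + 2 * |δ₁| ≤ K := by linarith [abs_nonneg δ₀]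
  have hKpos : 0 < K := lt_of_lt_of_le (by positivity) hK₀
  set b : ℝ := s ^ 2 * (m ^ 2 / (2 * K ^ 2)) with hb
  have hb0 : 0 < b := by positivity
  -- Chosen so that the drift is at least `3 a D` minus the shortfall term, leaving room for a
  -- threshold at `a D`.
  set a : ℝ := b / (4 * (m + 1)) with ha
  have ha0 : 0 < a := by positivity
  refine ⟨2 * (s ^ 2 * m ^ 2 / a ^ 2), b * (m + 1) * m ^ 2 / a, fun τ n hτ hn => ?_⟩
  have hτ1 : 1 ≤ τ := by omega
  set D : ℝ := ((n - τ : ℕ) : ℝ) with hD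
  have hD0 : 0 < D := Nat.cast_pos.2 (Nat.sub_pos_of_lt hn)
  have hτ0 : (0 : ℝ) < τ := by exact_mod_cast hτ1
  set M₀ := pathSum (centeredHits m δ₀ τ) n with hM₀
  set M₁ := pathSum (centeredHits m δ₁ τ) n with hM₁
  set W := pathSum (relativeShortfallSq m τ) n with hW
  set φ : LabeledGraph n → ℝ := fun G => if a * D ≤ s * M₀ G then 1 else 0 with hφ
  have hφ01 : ∀ G, φ G ∈ Set.Icc (0 : ℝ) 1 := fun G => by
    simp only [hφ]
    split_ifs <;> simp
  have hφ01' : ∀ G, 1 - φ G ∈ Set.Icc (0 : ℝ) 1 := fun G =>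
    ⟨sub_nonneg.2 (hφ01 G).2, sub_le_self _ (hφ01 G).1⟩
  have hW0 : ∀ G, 0 ≤ W G := by
    have : ∀ k G, 0 ≤ pathSum (relativeShortfallSq m τ) k G := by
      intro k
      induction k with
      | zero => exact fun _ => le_rfl
      | succ k ih =>
        intro G
        refine add_nonneg (ih _) ?_
        unfold relativeShortfallSq
        split_ifs <;> positivity
    exact this n
  set e : ℝ := s ^ 2 / (a * D) ^ 2 with he
  have he0 : 0 ≤ e := by positivity
  set f : ℝ := b * (m + 1) / (a * D) with hf
  have hf0 : 0 ≤ f := by positivity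
  have hcheb : ∀ x : ℝ, a * D ≤ |s * x| → 1 ≤ e * x ^ 2 := by
    intro x hx
    rw [he, div_mul_eq_mul_div, one_le_div (by positivity), ← mul_pow, ← sq_abs (s * x)]
    exact pow_le_pow_left₀ (by positivity) hx 2
  have h0 : ∀ G, φ G ≤ e * M₀ G ^ 2 := by
    intro G
    simp only [hφ]
    split_ifs with h
    · exact hcheb _ (h.trans (le_abs_self _))
    · positivity
  have h1 : ∀ G, 1 - φ G ≤ e * M₁ G ^ 2 + f * W G := by
    intro G
    have hWG := hW0 G
    simp only [hφ]
    split_ifs with h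
    · rw [sub_self]
      positivity
    · rw [sub_zero]
      have hsep := le_pathSum_centeredHits_sub hm hδ₀ hδ₁ hK₀ hK₁ hτ n G
      rw [← hs, ← hb, ← hD, ← hM₀, ← hM₁, ← hW] at hsep
      have h3 : b * (3 / (4 * (m + 1)) * D - (m + 1) * W G) =
          3 * (a * D) - b * (m + 1) * W G := by
        rw [ha]
        ring
      rw [h3] at hsep
      -- When the test misses the change, either the martingale `s * M₁` is at most `-a D`
      -- (Chebyshev), or the shortfall term has used up at least `a D` of the drift (Markov).
      rcases le_or_gt (a * D) (-(s * M₁ G)) with h4 | h4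
      · have := hcheb (M₁ G) (h4.trans (neg_le_abs _))
        have : 0 ≤ f * W G := by positivity
        linarith
      · have h5 : 1 ≤ f * W G := by
          rw [hf, div_mul_eq_mul_div, one_le_div (by positivity)]
          linarith
        have : 0 ≤ e * M₁ G ^ 2 := by positivity
        linarith
  refine ⟨φ, hφ01, ?_⟩
  have hfin₀ := support_prefAttachLaw_finite m (fun _ => δ₀) n
  have hfin₁ := support_prefAttachLaw_finite m (changeParam δ₀ δ₁ τ) n
  have hlt := neg_lt_changeParam hδ₀ hδ₁ τ
  have hchange : ∀ t, τ < t → changeParam δ₀ δ₁ τ t = δ₁ := fun t ht => if_neg (by omega)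
  have hQ₀ : (prefAttachLaw m (fun _ => δ₀) n).expect φ ≤ e * (m ^ 2 * D) := by
    refine (PMF.expect_mono hfin₀ fun G _ => h0 G).trans ?_
    rw [PMF.expect_const_mul]
    exact mul_le_mul_of_nonneg_left
      (expect_sq_pathSum_centeredHits_le hδ₀ hτ1 (fun _ _ => rfl) n) he0
  have hQ₁ : (prefAttachLaw m (changeParam δ₀ δ₁ τ) n).expect (fun G => 1 - φ G) ≤
      e * (m ^ 2 * D) + f * (m ^ 2 / τ * D) := by
    refine (PMF.expect_mono hfin₁ fun G _ => h1 G).trans ?_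
    rw [PMF.expect_add hfin₁, PMF.expect_const_mul, PMF.expect_const_mul]
    exact add_le_add
      (mul_le_mul_of_nonneg_left (expect_sq_pathSum_centeredHits_le hδ₁ hτ1 hchange n) he0)
      (mul_le_mul_of_nonneg_left (expect_pathSum_relativeShortfallSq_le hm hlt hτ1 n) hf0)
  rw [errorSum, nullLaw, altLaw, PMF.integral_toMeasure_eq_expect _ hφ01,
    PMF.integral_toMeasure_eq_expect _ hφ01']
  calc _ ≤ e * (m ^ 2 * D) + (e * (m ^ 2 * D) + f * (m ^ 2 / τ * D)) := add_le_add hQ₀ hQ₁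
    _ = _ := by
      rw [he, hf]
      field_simp
      ring

theorem tendsto_errorSum_likelihoodRatioTest (hm : 1 ≤ m) (hδ₀ : -(m : ℝ) < δ₀)
    (hδ₁ : -(m : ℝ) < δ₁) (hne : δ₀ ≠ δ₁) {τ : ℕ → ℕ} (hτ : Tendsto τ atTop atTop)
    (hΔ : Tendsto (fun n => n - τ n) atTop atTop) :
    Tendsto (fun n => errorSum (nullLaw m δ₀ n) (altLaw m δ₀ δ₁ (τ n) n)
      (likelihoodRatioTest (nullLaw m δ₀ n) (altLaw m δ₀ δ₁ (τ n) n))) atTop (𝓝 0) := by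
  obtain ⟨A, B, h⟩ := exists_errorSum_le hm hδ₀ hδ₁ hne
  have hlim : Tendsto (fun n => A / ((n - τ n : ℕ) : ℝ) + B / (τ n : ℝ)) atTop (𝓝 0) := by
    rw [← add_zero (0 : ℝ)]
    exact ((tendsto_natCast_atTop_atTop.comp hΔ).const_div_atTop A).add
      ((tendsto_natCast_atTop_atTop.comp hτ).const_div_atTop B)
  refine tendsto_of_tendsto_of_tendsto_of_le_of_le' tendsto_const_nhds hlim ?_ ?_
  · refine Eventually.of_forall fun n => ?_
    have h01 := likelihoodRatioTest_mem_Icc (nullLaw m δ₀ n) (altLaw m δ₀ δ₁ (τ n) n)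
    exact add_nonneg (integral_nonneg fun x => (h01 x).1)
      (integral_nonneg fun x => sub_nonneg.2 (h01 x).2)
  · filter_upwards [hτ.eventually_ge_atTop 2, hΔ.eventually_ge_atTop 1] with n h2 h1
    obtain ⟨φ, hφ, hle⟩ := h (τ n) n h2 (by omega)
    exact (errorSum_likelihoodRatioTest_le (altLaw_absolutelyContinuous hδ₀ hδ₁ (τ n) n)
      Measurable.of_discrete hφ).trans hle

theorem contiguous_of_limsup_lt_top (hδ₀ : -(m : ℝ) < δ₀) (hδ₁ : -(m : ℝ) < δ₁) {τ : ℕ → ℕ}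
    (hΔ : limsup (fun n => ((n - τ n : ℕ) : ℕ∞)) atTop < ⊤) :
    Contiguous (fun n => altLaw m δ₀ δ₁ (τ n) n) (fun n => nullLaw m δ₀ n) := by
  obtain ⟨C, hC, hle⟩ := exists_altLaw_le hδ₀ hδ₁
  obtain ⟨k, hk⟩ := ENat.ne_top_iff_exists.1 hΔ.ne
  have hev : ∀ᶠ n in atTop, n - τ n ≤ k := by
    have : ∀ᶠ n in atTop, ((n - τ n : ℕ) : ℕ∞) < ((k + 1 : ℕ) : ℕ∞) :=
      eventually_lt_of_limsup_lt (by rw [← hk]; exact_mod_cast Nat.lt_succ_self k)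
    filter_upwards [this] with n hn
    exact Nat.lt_succ_iff.1 (by exact_mod_cast hn)
  intro A _ hA
  have hlim : Tendsto (fun n => ENNReal.ofReal (C ^ k) * nullLaw m δ₀ n (A n)) atTop (𝓝 0) := by
    rw [← mul_zero (ENNReal.ofReal (C ^ k))]
    exact ENNReal.Tendsto.const_mul hA (Or.inr ENNReal.ofReal_ne_top)
  refine tendsto_of_tendsto_of_tendsto_of_le_of_le' tendsto_const_nhds hlim
    (Eventually.of_forall fun _ => zero_le) ?_
  filter_upwards [hev] with n hn
  exact (hle (τ n) n (A n)).trans (mul_le_mul_left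
    (ENNReal.ofReal_le_ofReal (pow_le_pow_right₀ hC hn)) _)

theorem tendsto_of_detectionPossible (hδ₀ : -(m : ℝ) < δ₀) (hδ₁ : -(m : ℝ) < δ₁) {τ : ℕ → ℕ}
    (h : DetectionPossible (fun n => nullLaw m δ₀ n) (fun n => altLaw m δ₀ δ₁ (τ n) n)) :
    Tendsto (fun n => n - τ n) atTop atTop := by
  obtain ⟨C, hC, hle⟩ := exists_altLaw_le hδ₀ hδ₁
  obtain ⟨φ, hφ, hφ01, hlim⟩ := h
  refine tendsto_atTop.2 fun k => ?_
  have hC0 : 0 < C ^ k := by positivity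
  filter_upwards [hlim.eventually_lt_const (inv_pos.2 hC0)] with n hn
  by_contra! hk
  -- If `n - τ n < k`, the errors are at least `C ^ (-(n - τ n)) ≥ C ^ (-k)`, contradicting the
  -- choice of `n`.
  have h1 := one_le_mul_errorSum (one_le_pow₀ hC) (hle (τ n) n) (hφ n) (hφ01 n)
  have h2 : 0 < errorSum (nullLaw m δ₀ n) (altLaw m δ₀ δ₁ (τ n) n) (φ n) :=
    pos_of_mul_pos_right (zero_lt_one.trans_le h1) (by positivity)
  have h3 : C ^ (n - τ n) * errorSum (nullLaw m δ₀ n) (altLaw m δ₀ δ₁ (τ n) n) (φ n) ≤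
      C ^ k * errorSum (nullLaw m δ₀ n) (altLaw m δ₀ δ₁ (τ n) n) (φ n) :=
    mul_le_mul_of_nonneg_right (pow_le_pow_right₀ hC hk.le) h2.le
  have h4 := mul_lt_mul_of_pos_left hn hC0
  rw [mul_inv_cancel₀ hC0.ne'] at h4
  linarith

end Detection

theorem mainTheorem2 (m : ℕ) (hm : 1 ≤ m) (δ₀ δ₁ : ℝ) (hδ₀ : -(m : ℝ) < δ₀) (hδ₁ : -(m : ℝ) < δ₁)
    (τ : ℕ → ℕ) (hτ : ∀ n, 1 ≤ n → 1 ≤ τ n ∧ τ n ≤ n) :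
    -- detection by the likelihood-ratio test
    (δ₀ ≠ δ₁ → Tendsto τ atTop atTop → Tendsto (fun n => n - τ n) atTop atTop →
      Tendsto (fun n => errorSum (nullLaw m δ₀ n) (altLaw m δ₀ δ₁ (τ n) n)
        (likelihoodRatioTest (nullLaw m δ₀ n) (altLaw m δ₀ δ₁ (τ n) n))) atTop (𝓝 0)) ∧
    -- contiguity when the number of steps after the change stays bounded
    (limsup (fun n => ((n - τ n : ℕ) : ℕ∞)) atTop < ⊤ →
      Contiguous (fun n => altLaw m δ₀ δ₁ (τ n) n) (fun n => nullLaw m δ₀ n)) ∧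
    -- the exact threshold for detection
    (DetectionPossible (fun n => nullLaw m δ₀ n) (fun n => altLaw m δ₀ δ₁ (τ n) n) →
      Tendsto (fun n => n - τ n) atTop atTop) ∧
    (δ₀ ≠ δ₁ → Tendsto τ atTop atTop →
      (DetectionPossible (fun n => nullLaw m δ₀ n) (fun n => altLaw m δ₀ δ₁ (τ n) n) ↔
        Tendsto (fun n => n - τ n) atTop atTop)) := by
  have hLRT := fun hne hτ' hΔ => tendsto_errorSum_likelihoodRatioTest (τ := τ) hm hδ₀ hδ₁ hne hτ' hΔ
  refine ⟨hLRT, contiguous_of_limsup_lt_top hδ₀ hδ₁, tendsto_of_detectionPossible hδ₀ hδ₁,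
    fun hne hτ' => ⟨tendsto_of_detectionPossible hδ₀ hδ₁, fun hΔ => ?_⟩⟩
  exact ⟨fun n => likelihoodRatioTest (nullLaw m δ₀ n) (altLaw m δ₀ δ₁ (τ n) n),
    fun n => measurable_likelihoodRatioTest _ _, fun n => likelihoodRatioTest_mem_Icc _ _,
    hLRT hne hτ' hΔ⟩
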